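/- Conventions. $L$ is a relational language without $0$-ary relation symbols (it may be infinite), and in every $L$-structure, $R(x_0,\dots,x_{n-1})$ implies that $x_0,\dots,x_{n-1}$ are pairwise distinct. The age $\rho(\mathrm A)$ of a structure $\mathrm A$ is the class of all finite $L$-structures that embed into $\mathrm A$ (embeddings preserve and reflect all relations). A structure $\mathrm U$ is homogeneous if every embedding of a finite induced substructure of $\mathrm U$ into $\mathrm U$ extends to an automorphism of $\mathrm U$. If $\mathrm M$ and $\mathrm M'$ have domains $B\cup C$ and $B\cup C'$, with $B,C,C'$ pairwise disjoint, and induce the same structure on $B$, then their free amalgam is the structure on $B\cup C\cup C'$ which induces $\mathrm M$ on $B\cup C$ and $\mathrm M'$ on $B\cup C'$, and in which no tuple satisfying a relation has both an entry in $C$ and an entry in $C'$. A class of finite structures is a free amalgamation class if it is closed under induced substructures and contains the free amalgam of every such pair of its members. A type of $\mathrm U$ is a pair $\langle F\mid x\rangle$ with $F\subseteq U$ finite and $x\in U\setminus F$; its typeset $\sigma\langle F\mid x\rangle$ is the orbit of $x$ under the group of automorphisms of $\mathrm U$ that fix $F$ pointwise, and its rank is the age of the substructure of $\mathrm U$ induced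 on this typeset. The structure $\mathrm U$ is rank linear if the set of the ranks of its types is linearly ordered by inclusion. It is indivisible if for every colouring $c:U\to\{0,1\}$ there is an embedding $f:\mathrm U\to\mathrm U$ such that $c$ is constant on $f[U]$, and divisible otherwise. Theorem. Let $\mathrm U$ be a countable homogeneous $L$-structure whose age is a free amalgamation class. If $\mathrm U$ is not rank linear, then $\mathrm U$ is divisible, that is, some colouring of $U$ with two colours admits no monochromatic copy of $\mathrm U$ in $\mathrm U$. -/

import Mathlib

universe u v w

namespace FreeAmalg

open FirstOrder.Language Set CategoryTheory
open scoped FirstOrder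

/-- The convention on relational structures: no `0`-ary relation symbols, and the entries of every
tuple satisfying a relation are pairwise distinct. -/
structure IsProper (L : FirstOrder.Language.{u, v}) (M : Type w) [L.Structure M] : Prop where
  no_nullary : IsEmpty (L.Relations 0)
  injective_of_relMap : ∀ {n : ℕ} (R : L.Relations n) (t : Fin n → M),
    Structure.RelMap R t → Function.Injective t

/-- Adjacency in the Gaifman graph: `a ≠ b` both occur in a tuple satisfying some relation. -/
def GaifmanAdj (L : FirstOrder.Language.{u, v}) {M : Type w} [L.Structure M] (a b : M) : Prop :=
  a ≠ b ∧ ∃ (n : ℕ) (R : L.Relations n) (t : Fin n → M),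
    Structure.RelMap R t ∧ a ∈ range t ∧ b ∈ range t

/-- For an amalgamation instance `M ← B → M'` (embeddings `f`, `f'`), the structure `N`, with
embeddings `g : M → N` and `g' : M' → N`, is the free amalgam of `M` and `M'` over `B`: the square
commutes, `N` is the union of the images of `M` and `M'`, which meet exactly in the image of `B`,
and no point of `M` outside `B` is Gaifman-adjacent to a point of `M'` outside `B`. -/
structure IsFreeAmalgam {L : FirstOrder.Language.{u, v}} {B M M' N : Type w}
    [L.Structure B] [L.Structure M] [L.Structure M'] [L.Structure N]
    (f : B ↪[L] M) (f' : B ↪[L] M') (g : M ↪[L] N) (g' : M' ↪[L] N) : Prop where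
  comm : ∀ b : B, g (f b) = g' (f' b)
  union_eq : range g ∪ range g' = univ
  inter_eq : range g ∩ range g' = range fun b => g (f b)
  not_adj : ∀ x ∈ range g \ range g', ∀ y ∈ range g' \ range g, ¬ GaifmanAdj L x y

/-- A class of structures is a free amalgamation class if it is closed under (finitely generated,
that is, in a relational language, finite) induced substructures and contains the free amalgam of
every amalgamation instance of its members. -/
structure IsFreeAmalgamationClass {L : FirstOrder.Language.{u, v}}
    (K : Set (Bundled.{w} L.Structure)) : Prop where
  hereditary : Hereditary K
  free_amalgam_mem : ∀ (B M M' N : Bundled.{w} L.Structure)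
    (f : B ↪[L] M) (f' : B ↪[L] M') (g : M ↪[L] N) (g' : M' ↪[L] N),
    M ∈ K → M' ∈ K → IsFreeAmalgam f f' g g' → N ∈ K

/-- A type `⟨F ; x⟩` of a structure: a finite set `F`, the sockel, and a point `x` outside `F`. -/
structure PointType (U : Type w) where
  sockel : Finset U
  point : U
  point_notMem : point ∉ sockel

/-- The typeset of `⟨F ; x⟩`: the points outside `F` in the orbit of `x` under the automorphisms
that fix `F` pointwise. -/
def PointType.typeset (L : FirstOrder.Language.{u, v}) {U : Type w} [L.Structure U] (T : PointType U) :
    Set U :=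
  {y | y ∉ T.sockel ∧ ∃ g : U ≃[L] U, (∀ a ∈ T.sockel, g a = a) ∧ g T.point = y}

/-- The age of a subset `S` of `U`: the age of the substructure induced on `S`. In a relational
language, the carrier of `Substructure.closure L S` is `S` itself. -/
def ageOn (L : FirstOrder.Language.{u, v}) {U : Type w} [L.Structure U] (S : Set U) :
    Set (Bundled.{w} L.Structure) :=
  L.age (Substructure.closure L S)

/-- The rank of a type: the age of its typeset. -/
def PointType.rank (L : FirstOrder.Language.{u, v}) {U : Type w} [L.Structure U] (T : PointType U) :
    Set (Bundled.{w} L.Structure) :=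
  ageOn L (T.typeset L)

/-- The set of ranks of all types of `U`. -/
def ranks (L : FirstOrder.Language.{u, v}) (U : Type w) [L.Structure U] :
    Set (Set (Bundled.{w} L.Structure)) :=
  range fun T : PointType U => T.rank L

/-- `U` is rank linear if its ranks are linearly ordered by inclusion. -/
def RankLinear (L : FirstOrder.Language.{u, v}) (U : Type w) [L.Structure U] : Prop :=
  ∀ r ∈ ranks L U, ∀ s ∈ ranks L U, r ⊆ s ∨ s ⊆ r

/-- `U` is indivisible if for every 2-colouring of `U` there is a copy of `U` in `U` (the image of
an embedding of `U` into itself) on which the colouring is constant. -/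
def Indivisible (L : FirstOrder.Language.{u, v}) (U : Type w) [L.Structure U] : Prop :=
  ∀ c : U → Fin 2, ∃ (f : U ↪[L] U) (i : Fin 2), ∀ x ∈ range f, c x = i

/-- `U` is divisible if it is not indivisible. -/
def Divisible (L : FirstOrder.Language.{u, v}) (U : Type w) [L.Structure U] : Prop :=
  ¬ Indivisible L U

end FreeAmalg

/-! Take two types `T` and `T'`. Each typeset has only countably many automorphic images ("copies"),
so `exists_colouring` compares two enumerations to give a colouring in which the points of colour
`0` in a copy for `T` are covered by finitely many copies for `T'`, and the points of colour `1` in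
a copy for `T'` by finitely many copies for `T`. A self-embedding of colour `0` sends the typeset of
`T` into one of its copies, hence into finitely many copies for `T'`. Typesets are age indivisible
(`PointType.hasFiniteCopies_or`), so a single one of these carries the whole rank of `T`, and `rank
T ⊆ rank T'`. Colour `1` gives the reverse inclusion, so incomparable ranks force divisibility.

Age indivisibility is where free amalgamation enters. If `X ∪ Y` covers a typeset and `Y` has no
copy of `B`, copies of `A` in `X` are built point by point: copies of the part already built are
attached to every point of a copy of `B`. Some point of that copy lies outside `Y`, hence in `X`,
and completes its attached piece. -/

namespace FreeAmalg

open FirstOrder.Language Set CategoryTheory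
open scoped FirstOrder

/-! ### Extending partial isomorphisms; free independence. -/

section Automorphisms

variable {L : FirstOrder.Language.{u, v}} {U : Type w} [L.Structure U]

/-- The automorphism `g` fixes every point of `F`. -/
def Fixes (g : U ≃[L] U) (F : Set U) : Prop := ∀ p ∈ F, g p = p

theorem Fixes.mono {g : U ≃[L] U} {F F' : Set U} (h : Fixes g F') (hF : F ⊆ F') : Fixes g F :=
  fun p hp => h p (hF hp)

theorem Fixes.comp {g h : U ≃[L] U} {F : Set U} (hg : Fixes g F) (hh : Fixes h F) :
    Fixes (g.comp h) F := fun p hp => by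
  rw [Equiv.comp_apply, hh p hp, hg p hp]

theorem Fixes.symm {g : U ≃[L] U} {F : Set U} (hg : Fixes g F) : Fixes g.symm F := fun p hp => by
  conv_lhs => rw [← hg p hp]
  exact g.symm_apply_apply p

theorem fixes_refl (F : Set U) : Fixes (FirstOrder.Language.Equiv.refl L U) F := fun _ _ => rfl

theorem Fixes.apply_mem_iff {g : U ≃[L] U} {F : Set U} (hg : Fixes g F) {p : U} :
    g p ∈ F ↔ p ∈ F := by
  constructor
  · intro h
    have := hg _ h
    rwa [← g.injective this]
  · intro h
    rwa [hg p h]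

/-- A partial isomorphism with finite domain extends to an automorphism. -/
theorem exists_equiv_of_partial_iso [L.IsRelational] (hhom : L.IsUltrahomogeneous U)
    {P : Set U} (hP : P.Finite) (φ : U → U) (hinj : InjOn φ P)
    (hrel : ∀ {n : ℕ} (R : L.Relations n) (t : Fin n → U), (∀ i, t i ∈ P) →
      (Structure.RelMap R (φ ∘ t) ↔ Structure.RelMap R t)) :
    ∃ g : U ≃[L] U, ∀ p ∈ P, g p = φ p := by
  have hmem (x : Substructure.closure L P) : (x : U) ∈ P :=
    (Substructure.mem_closure_iff_of_isRelational L _ _).1 x.2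
  let f : Substructure.closure L P ↪[L] U :=
    { toFun := fun x => φ x
      inj' := fun x y h => Subtype.ext (hinj (hmem x) (hmem y) h)
      map_fun' := fun F => isEmptyElim F
      map_rel' := fun R t => hrel R (fun i => (t i : U)) fun i => hmem (t i) }
  obtain ⟨g, hg⟩ := hhom _ (Substructure.fg_closure hP) f
  refine ⟨g, fun p hp => ?_⟩
  exact (DFunLike.congr_fun hg ⟨p, by simpa using hp⟩).symm

variable (L) in
/-- `Q` and `X` are freely independent over `P`: they meet inside `P`, and the structure induced on
`P ∪ Q ∪ X` is the free amalgam over `P` of those induced on `P ∪ Q` and on `P ∪ X`. -/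
structure FreeIndep (P Q X : Set U) : Prop where
  inter_subset : ∀ a ∈ Q, a ∈ X → a ∈ P
  subset_or : ∀ {n : ℕ} (R : L.Relations n) (t : Fin n → U), Structure.RelMap R t →
    (∀ i, t i ∈ P ∨ t i ∈ Q ∨ t i ∈ X) →
      (∀ i, t i ∈ P ∨ t i ∈ Q) ∨ ∀ i, t i ∈ P ∨ t i ∈ X

theorem FreeIndep.mono {P Q Q' X X' : Set U} (h : FreeIndep L P Q X) (hQ : Q' ⊆ Q)
    (hX : X' ⊆ X) : FreeIndep L P Q' X' where
  inter_subset a ha ha' := h.inter_subset a (hQ ha) (hX ha')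
  subset_or R t hR ht := by
    rcases h.subset_or R t hR (fun i => (ht i).imp id (Or.imp (@hQ _) (@hX _))) with h' | h'
    · refine Or.inl fun i => ?_
      rcases ht i with h1 | h1 | h1
      · exact .inl h1
      · exact .inr h1
      · exact .inl ((h' i).elim id fun h2 => h.inter_subset _ h2 (hX h1))
    · refine Or.inr fun i => ?_
      rcases ht i with h1 | h1 | h1
      · exact .inl h1
      · exact .inl ((h' i).elim id fun h2 => h.inter_subset _ (hQ h1) h2)
      · exact .inr h1

theorem freeIndep_empty (P X : Set U) : FreeIndep L P ∅ X where
  inter_subset _ h := h.elim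
  subset_or _ _ _ ht := Or.inr fun i => (ht i).imp id fun h => h.elim (fun h => h.elim) id

/-- Left transitivity of free independence. -/
theorem FreeIndep.trans {P C Q E : Set U} (h : FreeIndep L (P ∪ C) Q E) (hC : FreeIndep L P C E) :
    FreeIndep L P (C ∪ Q) E where
  inter_subset a ha ha' := by
    rcases ha with ha | ha
    · exact hC.inter_subset a ha ha'
    · rcases h.inter_subset a ha ha' with h' | h'
      · exact h'
      · exact hC.inter_subset a h' ha'
  subset_or R t hR ht := by
    rcases h.subset_or R t hR (fun i => by
      rcases ht i with h1 | (h1 | h1) | h1 <;> simp [h1]) with h' | h'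
    · refine Or.inl fun i => ?_
      rcases h' i with (h1 | h1) | h1 <;> simp [h1]
    · rcases hC.subset_or R t hR (fun i => by
        rcases h' i with (h1 | h1) | h1 <;> simp [h1]) with h'' | h''
      · exact Or.inl fun i => (h'' i).imp id Or.inl
      · exact Or.inr h''

/-- Freely independent finite sets have only one amalgam: an automorphism that fixes `F` may be
replaced on `Q` by one which also fixes `C`. -/
theorem FreeIndep.exists_fixes_union [L.IsRelational] (hhom : L.IsUltrahomogeneous U)
    {F Q C : Set U} (hF : F.Finite) (hQ : Q.Finite) (hC : C.Finite) {γ : U ≃[L] U}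
    (hγ : Fixes γ F) (h : FreeIndep L F Q C) (h' : FreeIndep L F (γ '' Q) C) :
    ∃ θ : U ≃[L] U, Fixes θ (F ∪ C) ∧ ∀ q ∈ Q, θ q = γ q := by
  classical
  -- The identity on `F ∪ C` and `γ` on `Q` agree where they overlap, since `Q ∩ C ⊆ F` and `γ`
  -- fixes `F`.
  let φ : U → U := fun v => if v ∈ F ∪ C then v else γ v
  have hφ1 (v) (hv : v ∈ F ∪ C) : φ v = v := if_pos hv
  have hφ2 (v) (hv : v ∈ F ∨ v ∈ Q) : φ v = γ v := by
    by_cases hv' : v ∈ F ∪ C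
    · have : v ∈ F := by
        rcases hv with hv | hv
        · exact hv
        · exact hv'.elim id fun h1 => h.inter_subset v hv h1
      rw [hφ1 v hv', hγ v this]
    · exact if_neg hv'
  have hback (v) (hv : v ∈ Q) (hv' : γ v ∈ F ∪ C) : v ∈ F := by
    refine hγ.apply_mem_iff.1 (hv'.elim id fun h1 => ?_)
    exact h'.inter_subset _ ⟨v, hv, rfl⟩ h1
  obtain ⟨θ, hθ⟩ := exists_equiv_of_partial_iso hhom (P := F ∪ C ∪ Q) ((hF.union hC).union hQ) φ
    (by
      have key : ∀ a ∈ F ∪ C, ∀ b ∈ Q, φ a = φ b → a = b := by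
        intro a ha b hb hab
        rw [hφ1 a ha, hφ2 b (.inr hb)] at hab
        have hbF := hback b hb (hab ▸ ha)
        rw [hab, hγ b hbF]
      intro a ha b hb hab
      rcases ha with ha | ha <;> rcases hb with hb | hb
      · rwa [hφ1 a ha, hφ1 b hb] at hab
      · exact key a ha b hb hab
      · exact (key b hb a ha hab.symm).symm
      · rw [hφ2 a (.inr ha), hφ2 b (.inr hb)] at hab
        exact γ.injective hab)
    (by
      intro n R t ht
      have hid (h1 : ∀ i, t i ∈ F ∨ t i ∈ C) : φ ∘ t = t := funext fun i => hφ1 _ (h1 i)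
      have hga (h1 : ∀ i, t i ∈ F ∨ t i ∈ Q) : φ ∘ t = γ ∘ t := funext fun i => hφ2 _ (h1 i)
      constructor
      · intro hR
        rcases h'.subset_or R _ hR (fun i => by
          rcases ht i with h1 | h1
          · rw [Function.comp_apply, hφ1 _ h1]
            exact h1.imp id Or.inr
          · rw [Function.comp_apply, hφ2 _ (.inr h1)]
            exact .inr (.inl ⟨_, h1, rfl⟩)) with h2 | h2
        · have h3 : ∀ i, t i ∈ F ∨ t i ∈ Q := fun i => by
            rcases ht i with (h1 | h1) | h1
            · exact .inl h1
            · have := h2 i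
              rw [Function.comp_apply, hφ1 _ (.inr h1)] at this
              exact .inl (this.elim id fun h4 => h'.inter_subset _ h4 h1)
            · exact .inr h1
          rw [hga h3] at hR
          exact (γ.map_rel R t).1 hR
        · have h3 : ∀ i, t i ∈ F ∨ t i ∈ C := fun i => by
            rcases ht i with h1 | h1
            · exact h1
            · have := h2 i
              rw [Function.comp_apply, hφ2 _ (.inr h1)] at this
              exact .inl (hback _ h1 this)
          rwa [hid h3] at hR
      · intro hR
        rcases h.subset_or R t hR (fun i => by
          rcases ht i with (h1 | h1) | h1 <;> simp [h1]) with h2 | h2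
        · rw [hga h2]
          exact (γ.map_rel R t).2 hR
        · rwa [hid h2])
  refine ⟨θ, fun p hp => ?_, fun q hq => ?_⟩
  · rw [hθ p (.inl hp), hφ1 p hp]
  · rw [hθ q (.inr hq), hφ2 q (.inr hq)]

end Automorphisms

/-! ### Realising free amalgams by automorphisms. -/

section FreeExtension

variable {L : FirstOrder.Language.{u, v}} {U : Type w} [L.Structure U]

/-- The domain of the free amalgam of `P ∪ Q` and `P ∪ X` over `P`: points with label `true` stand
for `P ∪ X`, those with label `false` for `Q \ P`. -/
def Glued (P Q X : Set U) : Type w :=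
  {z : U × Bool // (z.2 = true → z.1 ∈ P ∪ X) ∧ (z.2 = false → z.1 ∈ Q ∧ z.1 ∉ P)}

/-- The free amalgam of the structures induced on `P ∪ Q` and `P ∪ X` over `P`. -/
instance Glued.instStructure [L.IsRelational] (P Q X : Set U) : L.Structure (Glued P Q X) where
  funMap F := isEmptyElim F
  RelMap R t := Structure.RelMap R (fun i => (t i).1.1) ∧
    ((∀ i, (t i).1.2 = false ∨ (t i).1.1 ∈ P) ∨ ∀ i, (t i).1.2 = true)

variable (L) in
open Classical in
/-- The inclusion of `P ∪ Q` into the free amalgam. -/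
noncomputable def Glued.left [L.IsRelational] (P Q X : Set U) :
    Substructure.closure L (P ∪ Q) ↪[L] Glued P Q X where
  toFun x := ⟨(x, decide ((x : U) ∈ P)), by
    have : (x : U) ∈ P ∪ Q := (Substructure.mem_closure_iff_of_isRelational L _ _).1 x.2
    simp only [decide_eq_true_eq, decide_eq_false_iff_not]
    exact ⟨fun h => .inl h, fun h => ⟨this.resolve_left h, h⟩⟩⟩
  inj' x y h := Subtype.ext (congrArg (fun z : Glued P Q X => z.1.1) h)
  map_fun' F := isEmptyElim F
  map_rel' R t := by
    refine ⟨fun h => h.1, fun h => ⟨h, .inl fun i => ?_⟩⟩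
    exact (Classical.em ((t i : U) ∈ P)).symm.imp_left fun h => decide_eq_false h

variable (L) in
/-- The inclusion of `P ∪ X` into the free amalgam. -/
def Glued.right [L.IsRelational] (P Q X : Set U) :
    Substructure.closure L (P ∪ X) ↪[L] Glued P Q X where
  toFun x := ⟨(x, true), by
    have : (x : U) ∈ P ∪ X := (Substructure.mem_closure_iff_of_isRelational L _ _).1 x.2
    exact ⟨fun _ => this, fun h => by cases h⟩⟩
  inj' x y h := Subtype.ext (congrArg (fun z : Glued P Q X => z.1.1) h)
  map_fun' F := isEmptyElim F
  map_rel' R t := ⟨fun h => h.1, fun h => ⟨h, .inr fun i => rfl⟩⟩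

open Classical in
theorem Glued.mem_range_left [L.IsRelational] {P Q X : Set U} (z : Glued P Q X) :
    z ∈ range (Glued.left L P Q X) ↔ z.1.2 = false ∨ z.1.1 ∈ P := by
  constructor
  · rintro ⟨x, rfl⟩
    exact (Classical.em ((x : U) ∈ P)).symm.imp_left fun h => decide_eq_false h
  · intro h
    obtain ⟨⟨a, b⟩, hz⟩ := z
    simp only at h hz
    refine ⟨⟨a, ?_⟩, ?_⟩
    · simp only [Substructure.mem_closure_iff_of_isRelational]
      exact h.elim (fun h => .inr (hz.2 h).1) .inl
    · refine Subtype.ext (Prod.ext rfl ?_)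
      cases b
      · exact decide_eq_false (hz.2 rfl).2
      · exact decide_eq_true (h.resolve_left (by simp))

theorem Glued.mem_range_right [L.IsRelational] {P Q X : Set U} (z : Glued P Q X) :
    z ∈ range (Glued.right L P Q X) ↔ z.1.2 = true := by
  constructor
  · rintro ⟨x, rfl⟩
    rfl
  · intro h
    refine ⟨⟨z.1.1, ?_⟩, Subtype.ext (Prod.ext rfl h.symm)⟩
    simpa using z.2.1 h

open Classical in
theorem Glued.isFreeAmalgam [L.IsRelational] (P Q X : Set U) :
    IsFreeAmalgam
      (Substructure.inclusion (Substructure.closure_mono (L := L) (subset_union_left : P ⊆ P ∪ Q)))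
      (Substructure.inclusion (Substructure.closure_mono (L := L) (subset_union_left : P ⊆ P ∪ X)))
      (Glued.left L P Q X) (Glued.right L P Q X) where
  comm b := by
    have hb : (b : U) ∈ P := (Substructure.mem_closure_iff_of_isRelational L _ _).1 b.2
    exact Subtype.ext (Prod.ext rfl (decide_eq_true hb))
  union_eq := by
    refine eq_univ_of_forall fun z => ?_
    rw [mem_union, Glued.mem_range_left, Glued.mem_range_right]
    cases z.1.2 <;> simp
  inter_eq := by
    ext z
    rw [mem_inter_iff, Glued.mem_range_left, Glued.mem_range_right]
    constructor
    · rintro ⟨h, h'⟩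
      have hP : z.1.1 ∈ P := h.resolve_left (by simp [h'])
      exact ⟨⟨z.1.1, by simpa using hP⟩,
        Subtype.ext (Prod.ext rfl ((decide_eq_true hP).trans h'.symm))⟩
    · rintro ⟨b, rfl⟩
      have hb : (b : U) ∈ P := (Substructure.mem_closure_iff_of_isRelational L _ _).1 b.2
      exact ⟨.inr hb, decide_eq_true hb⟩
  not_adj := by
    rintro x ⟨-, hx⟩ y ⟨-, hy⟩ ⟨-, n, R, t, ⟨-, ht⟩, ⟨i, rfl⟩, ⟨j, rfl⟩⟩
    rw [Glued.mem_range_right] at hx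
    rw [Glued.mem_range_left] at hy
    exact ht.elim (fun h => hy (h j)) fun h => hx (h i)

open Classical in
/-- In a homogeneous structure whose age is a free amalgamation class, `Q` has a copy over `P`
which is freely independent from `X`. -/
theorem exists_fixes_freeIndep [L.IsRelational] (hhom : L.IsUltrahomogeneous U)
    (hfree : IsFreeAmalgamationClass (L.age U)) {P Q X : Set U} (hP : P.Finite) (hQ : Q.Finite)
    (hX : X.Finite) : ∃ g : U ≃[L] U, Fixes g P ∧ FreeIndep L P (g '' Q) X := by
  have hage {S : Set U} (hS : S.Finite) :
      (Bundled.of (Substructure.closure L S) : Bundled.{w} L.Structure) ∈ L.age U :=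
    ⟨(Substructure.fg_iff_structure_fg _).1 (Substructure.fg_closure hS),
      ⟨Substructure.subtype _⟩⟩
  obtain ⟨-, ⟨ι⟩⟩ := hfree.free_amalgam_mem (Bundled.of (Substructure.closure L P))
    (Bundled.of (Substructure.closure L (P ∪ Q))) (Bundled.of (Substructure.closure L (P ∪ X)))
    (Bundled.of (Glued P Q X)) _ _ _ _ (hage (hP.union hQ)) (hage (hP.union hX))
    (Glued.isFreeAmalgam P Q X)
  change Glued P Q X ↪[L] U at ι
  obtain ⟨h, hh⟩ := hhom _ (Substructure.fg_closure (hP.union hX)) (ι.comp (Glued.right L P Q X))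
  obtain ⟨k, hk⟩ := hhom _ (Substructure.fg_closure (hP.union hQ)) (ι.comp (Glued.left L P Q X))
  have hh' (x : U) (hx : x ∈ P ∪ X) : ∃ z : Glued P Q X, z.1 = (x, true) ∧ h x = ι z := by
    refine ⟨Glued.right L P Q X ⟨x, by simpa using hx⟩, rfl, ?_⟩
    exact (DFunLike.congr_fun hh ⟨x, by simpa using hx⟩).symm
  have hk1 (x : U) (hx : x ∈ P) : ∃ z : Glued P Q X, z.1 = (x, true) ∧ k x = ι z := by
    refine ⟨Glued.left L P Q X ⟨x, by simp [hx]⟩, Prod.ext rfl (decide_eq_true hx), ?_⟩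
    exact (DFunLike.congr_fun hk ⟨x, by simp [hx]⟩).symm
  have hk2 (x : U) (hx : x ∈ Q) (hx' : x ∉ P) :
      ∃ z : Glued P Q X, z.1 = (x, false) ∧ k x = ι z := by
    refine ⟨Glued.left L P Q X ⟨x, by simp [hx]⟩, Prod.ext rfl (decide_eq_false hx'), ?_⟩
    exact (DFunLike.congr_fun hk ⟨x, by simp [hx]⟩).symm
  -- `h` and `k` move `P ∪ X` and `P ∪ Q` onto the two halves of the embedded amalgam; undoing `h`
  -- puts `P ∪ X` back in place.
  let g := h.symm.comp k
  have hhg (x : U) : h (g x) = k x := h.apply_symm_apply _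
  have hfix : Fixes g P := fun p hp => by
    obtain ⟨z, hz, hz'⟩ := hh' p (.inl hp)
    obtain ⟨y, hy, hy'⟩ := hk1 p hp
    apply h.injective
    rw [hhg, hz', hy', Subtype.ext (hy.trans hz.symm)]
  have hfalse (a : U) (ha : a ∈ g '' Q) (ha' : a ∉ P) :
      ∃ z : Glued P Q X, z.1.2 = false ∧ h a = ι z := by
    obtain ⟨q, hq, rfl⟩ := ha
    obtain ⟨z, hz, hz'⟩ := hk2 q hq fun h => ha' (hfix.apply_mem_iff.2 h)
    exact ⟨z, by rw [hz], by rw [hhg, hz']⟩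
  have hinter (a : U) (ha : a ∈ g '' Q) (ha' : a ∈ X) : a ∈ P := by
    by_contra hP'
    obtain ⟨z, hz, hz'⟩ := hfalse a ha hP'
    obtain ⟨y, hy, hy'⟩ := hh' a (.inr ha')
    have : z = y := ι.injective (hz'.symm.trans hy')
    rw [this, hy] at hz
    cases hz
  refine ⟨g, hfix, hinter, fun {n} R t hR ht => ?_⟩
  have hz : ∀ i, ∃ z : Glued P Q X, h (t i) = ι z ∧ (z.1.2 = true → t i ∈ P ∨ t i ∈ X) ∧
      (z.1.2 = false ∨ z.1.1 ∈ P → t i ∈ P ∨ t i ∈ g '' Q) := by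
    intro i
    by_cases hi : t i ∈ P ∪ X
    · obtain ⟨z, hz, hz'⟩ := hh' _ hi
      refine ⟨z, hz', fun _ => hi, fun h => ?_⟩
      rw [hz] at h
      exact .inl (h.resolve_left (by simp))
    · have hi' : t i ∈ g '' Q := by
        rcases ht i with h1 | h1 | h1
        · exact (hi (.inl h1)).elim
        · exact h1
        · exact (hi (.inr h1)).elim
      obtain ⟨z, hz, hz'⟩ := hfalse _ hi' fun h1 => hi (.inl h1)
      exact ⟨z, hz', fun h1 => by simp [hz] at h1, fun _ => .inr hi'⟩
  choose z hz1 hz2 hz3 using hz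
  have hzR : Structure.RelMap R z := by
    rw [← ι.map_rel, ← show h ∘ t = ι ∘ z from funext hz1, h.map_rel]
    exact hR
  exact hzR.2.imp (fun h i => hz3 i (h i)) fun h i => hz2 i (h i)

end FreeExtension

/-! ### Age indivisibility of typesets. -/

section Typesets

variable {L : FirstOrder.Language.{u, v}} {U : Type w} [L.Structure U]

theorem PointType.apply_mem_typeset {T : PointType U} {g : U ≃[L] U}
    (hg : Fixes g (T.sockel : Set U)) {y : U} (hy : y ∈ T.typeset L) : g y ∈ T.typeset L := by
  obtain ⟨h1, k, hk, rfl⟩ := hy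
  refine ⟨fun h => h1 (by simpa using hg.apply_mem_iff.1 (Finset.mem_coe.2 h)), g.comp k, ?_, rfl⟩
  exact hg.comp (h := k) hk

theorem PointType.exists_fixes_apply_eq {T : PointType U} {y z : U} (hy : y ∈ T.typeset L)
    (hz : z ∈ T.typeset L) : ∃ g : U ≃[L] U, Fixes g (T.sockel : Set U) ∧ g y = z := by
  obtain ⟨-, k, hk, rfl⟩ := hy
  obtain ⟨-, l, hl, rfl⟩ := hz
  refine ⟨l.comp k.symm, Fixes.comp (g := l) hl (Fixes.symm (g := k) hk), ?_⟩
  rw [Equiv.comp_apply, k.symm_apply_apply]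

/-- If `X` contains a copy of `A` freely independent from any given finite set, then a copy of
`B` can be placed freely so that each of its points extends such a copy of `A` like the point `a`. -/
theorem PointType.exists_attached_copies [L.IsRelational] (hhom : L.IsUltrahomogeneous U)
    (hfree : IsFreeAmalgamationClass (L.age U)) (T : PointType U) {X A B : Set U} {a : U}
    (hA : A.Finite) (hB : B.Finite) (haA : a ∉ A) (hAT : A ⊆ T.typeset L)
    (haT : a ∈ T.typeset L) (hBT : B ⊆ T.typeset L)
    (hcopy : ∀ E : Set U, E.Finite → ∃ g : U ≃[L] U, Fixes g (T.sockel : Set U) ∧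
      g '' A ⊆ X ∧ FreeIndep L (T.sockel : Set U) (g '' A) E)
    {B₀ : Set U} (hB₀ : B₀ ⊆ B) (E : Set U) (hE : E.Finite) :
    ∃ (g : U ≃[L] U) (C : Set U), Fixes g (T.sockel : Set U) ∧ C.Finite ∧
      (∀ b ∈ B, g b ∉ C) ∧
      (∀ b ∈ B₀, ∃ h : U ≃[L] U, Fixes h (T.sockel : Set U) ∧ h a = g b ∧ h '' A ⊆ X ∧
        h '' A ⊆ C) ∧
      FreeIndep L (T.sockel : Set U) (C ∪ g '' B) E := by
  set F : Set U := (T.sockel : Set U) with hFdef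
  have hF : F.Finite := T.sockel.finite_toSet
  induction B₀, hB.subset hB₀ using Set.Finite.induction_on with
  | empty =>
    obtain ⟨g, hg, hgE⟩ := exists_fixes_freeIndep hhom hfree hF hB hE
    exact ⟨g, ∅, hg, finite_empty, fun _ _ => notMem_empty _, fun _ h => h.elim, by simpa using hgE⟩
  | @insert b S _ _ ih =>
    obtain ⟨g, C, hg, hC, hgC, hS, hind⟩ := ih ((subset_insert _ _).trans hB₀)
    have hbB : b ∈ B := hB₀ (mem_insert _ _)
    have huT : g b ∈ T.typeset L := apply_mem_typeset hg (hBT hbB)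
    have huF : g b ∉ F := huT.1
    -- Freeness from `C` as well allows this copy in `X` to be glued to the earlier ones.
    obtain ⟨k, hk, hkX, hkE⟩ := hcopy (E ∪ C) (hE.union hC)
    obtain ⟨m₀, hm₀, hm₀a⟩ := exists_fixes_apply_eq haT huT
    -- A model of the desired attachment: a copy of `A` placed at `g b`, not yet inside `X`.
    obtain ⟨m₁, hm₁, hm₁ind⟩ := exists_fixes_freeIndep hhom hfree (P := insert (g b) F)
      (Q := m₀ '' A) (X := C ∪ g '' B) (hF.insert _) (hA.image _) (hC.union (hB.image _))
    let m := m₁.comp m₀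
    have hm : Fixes m F := (hm₁.mono (subset_insert _ _)).comp hm₀
    have hma : m a = g b := by
      rw [Equiv.comp_apply, hm₀a, hm₁ _ (mem_insert _ _)]
    have hmA : m₁ '' (m₀ '' A) = m '' A := by rw [image_image]; rfl
    rw [hmA] at hm₁ind
    have hmF (x) (hx : x ∈ m '' A) : x ∉ F := by
      rintro hxF
      obtain ⟨y, hy, rfl⟩ := hx
      exact (hAT hy).1 (hm.apply_mem_iff.1 hxF)
    have hmu (x) (hx : x ∈ m '' A) : x ≠ g b := by
      rintro rfl
      obtain ⟨y, hy, hyb⟩ := hx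
      exact haA (m.injective (hyb.trans hma.symm) ▸ hy)
    have hmd (x) (hx : x ∈ m '' A) : x ∉ C ∪ g '' B := fun hx' => by
      rcases hm₁ind.inter_subset x hx hx' with h | h
      · exact hmu x hx h
      · exact hmF x hx h
    -- The base shrinks from `F ∪ {g b}` to `F` because `g b` is in none of `F`, `m '' A`, `C`.
    have hmC : FreeIndep L F (m '' A) C := by
      refine ⟨fun x hx hx' => (hmd x hx (.inl hx')).elim, fun R t hR ht => ?_⟩
      have hu (i) : t i ≠ g b := by
        intro h
        rcases ht i with h1 | h1 | h1
        · exact huF (h ▸ h1)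
        · exact hmu _ h1 h
        · exact hgC b hbB (h ▸ h1)
      rcases hm₁ind.subset_or R t hR (fun i => by
        rcases ht i with h1 | h1 | h1
        · exact .inl (.inr h1)
        · exact .inr (.inl h1)
        · exact .inr (.inr (.inl h1))) with h' | h'
      · exact .inl fun i => (h' i).imp (fun h => h.resolve_left (hu i)) id
      · refine .inr fun i => ?_
        rcases ht i with h1 | h1 | h1
        · exact .inl h1
        · rcases h' i with h2 | h2
          · exact .inl (h2.resolve_left (hu i))
          · exact (hmd _ h1 h2).elim
        · exact .inr h1
    let γ := k.comp m.symm
    have hγm (x) : γ (m x) = k x := by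
      rw [Equiv.comp_apply, m.symm_apply_apply]
    have hγA : γ '' (m '' A) = k '' A := by
      rw [image_image]
      exact image_congr fun x _ => hγm x
    -- `θ` carries the model onto `k '' A ⊆ X` without disturbing the earlier attachments in `C`.
    obtain ⟨θ, hθ, hθA⟩ := hmC.exists_fixes_union hhom hF (hA.image _) hC (hk.comp hm.symm)
      (by rw [hγA]; exact hkE.mono subset_rfl subset_union_right)
    have hθm (x) (hx : x ∈ A) : θ (m x) = k x := by rw [hθA _ ⟨x, hx, rfl⟩]; exact hγm x
    have hFC : (F ∪ (C ∪ k '' A)).Finite := hF.union (hC.union (hA.image _))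
    -- `θ` may have spoiled the independence of the copy of `B` from `E`; `ξ` restores it, fixing
    -- all attached copies.
    obtain ⟨ξ, hξ, hξE⟩ := exists_fixes_freeIndep hhom hfree hFC
      (Q := θ '' (g '' B)) ((hB.image _).image _) hE
    have hξ' : Fixes ξ F := hξ.mono subset_union_left
    have hθ' : Fixes θ F := hθ.mono subset_union_left
    have himg : ξ '' (θ '' (g '' B)) = (ξ.comp (θ.comp g)) '' B := by
      rw [image_image, image_image]; rfl
    refine ⟨ξ.comp (θ.comp g), C ∪ k '' A, hξ'.comp (hθ'.comp hg), hC.union (hA.image _), ?_, ?_, ?_⟩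
    · intro b' hb' hmem
      have h1 : θ (g b') ∈ C ∪ k '' A :=
        (hξ.mono subset_union_right).apply_mem_iff.1 hmem
      rcases h1 with h1 | ⟨x, hx, h1⟩
      · exact hgC b' hb' ((hθ.mono subset_union_right).apply_mem_iff.1 h1)
      · rw [← hθm x hx] at h1
        exact hmd (m x) ⟨x, hx, rfl⟩ (.inr (θ.injective h1 ▸ ⟨b', hb', rfl⟩))
    · intro b' hb'
      rcases mem_insert_iff.1 hb' with rfl | hb'
      · have hval (x) (hx : x ∈ A) : ξ (θ (m x)) = k x := by
          rw [hθm x hx, hξ _ (.inr (.inr ⟨x, hx, rfl⟩))]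
        have himg' : (ξ.comp (θ.comp m)) '' A = k '' A := image_congr hval
        refine ⟨ξ.comp (θ.comp m), hξ'.comp (hθ'.comp hm), ?_, ?_, ?_⟩
        · simp only [Equiv.comp_apply, hma]
        · rwa [himg']
        · rw [himg']; exact subset_union_right
      · obtain ⟨h, hh, hha, hhX, hhC⟩ := hS b' hb'
        have hval (x) (hx : x ∈ A) : ξ (θ (h x)) = h x := by
          have hxC : h x ∈ C := hhC ⟨x, hx, rfl⟩
          rw [hθ _ (.inr hxC), hξ _ (.inr (.inl hxC))]
        have himg' : (ξ.comp (θ.comp h)) '' A = h '' A := image_congr hval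
        refine ⟨ξ.comp (θ.comp h), hξ'.comp (hθ'.comp hh), ?_, ?_, ?_⟩
        · simp only [Equiv.comp_apply, hha]
        · rwa [himg']
        · rw [himg']; exact hhC.trans subset_union_left
    · rw [himg] at hξE
      refine hξE.trans ?_
      refine FreeIndep.trans ?_ (hind.mono subset_union_left subset_rfl)
      refine ⟨fun x hx hx' => .inl (hkE.inter_subset x hx (.inl hx')), fun R t hR ht => ?_⟩
      rcases hkE.subset_or R t hR (fun i => by
        rcases ht i with (h1 | h1) | h1 | h1 <;> simp [h1]) with h' | h'
      · exact .inl fun i => (h' i).imp .inl id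
      · refine .inr fun i => ?_
        rcases h' i with h1 | h1 | h1 <;> simp [h1]

/-- If the typeset is covered by `X` and `Y`, and `Y` contains no copy of `B`, then `X` contains a
copy of every finite subset `A` of the typeset, and even a free one. -/
theorem PointType.exists_free_copy [L.IsRelational] (hhom : L.IsUltrahomogeneous U)
    (hfree : IsFreeAmalgamationClass (L.age U)) (T : PointType U) {X Y A B : Set U}
    (hXY : T.typeset L ⊆ X ∪ Y) (hA : A.Finite) (hAT : A ⊆ T.typeset L)
    (hB : B.Finite) (hBT : B ⊆ T.typeset L) (hBY : ∀ g : U ≃[L] U, ¬ g '' B ⊆ Y)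
    (E : Set U) (hE : E.Finite) :
    ∃ g : U ≃[L] U, Fixes g (T.sockel : Set U) ∧ g '' A ⊆ X ∧
      FreeIndep L (T.sockel : Set U) (g '' A) E := by
  induction A, hA using Set.Finite.induction_on generalizing E with
  | empty =>
    refine ⟨FirstOrder.Language.Equiv.refl L U, fixes_refl _, by simp, ?_⟩
    rw [image_empty]
    exact freeIndep_empty _ _
  | @insert a S haS hS ih =>
    obtain ⟨g, C, hg, -, -, hatt, hind⟩ := T.exists_attached_copies hhom hfree hS hB haS
      ((subset_insert _ _).trans hAT) (hAT (mem_insert _ _)) hBT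
      (ih ((subset_insert _ _).trans hAT)) subset_rfl E hE
    -- The point `g b` outside `Y` serves as the image of `a`.
    obtain ⟨y, ⟨b, hb, rfl⟩, hbY⟩ := not_subset.1 (hBY g)
    obtain ⟨h, hh, hha, hhX, hhC⟩ := hatt b hb
    refine ⟨h, hh, ?_, hind.mono ?_ subset_rfl⟩
    · rw [image_insert_eq, hha]
      exact insert_subset ((hXY (apply_mem_typeset hg (hBT hb))).resolve_right hbY) hhX
    · rw [image_insert_eq, hha]
      exact insert_subset (.inr ⟨b, hb, rfl⟩) (hhC.trans subset_union_left)

variable (L) in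
/-- Every finite subset of `S` has an automorphic image inside `X`. -/
def HasFiniteCopies (S X : Set U) : Prop :=
  ∀ Q : Set U, Q.Finite → Q ⊆ S → ∃ g : U ≃[L] U, g '' Q ⊆ X

/-- Typesets are age indivisible. -/
theorem PointType.hasFiniteCopies_or [L.IsRelational] (hhom : L.IsUltrahomogeneous U)
    (hfree : IsFreeAmalgamationClass (L.age U)) (T : PointType U) {X Y : Set U}
    (h : HasFiniteCopies L (T.typeset L) (X ∪ Y)) :
    HasFiniteCopies L (T.typeset L) X ∨ HasFiniteCopies L (T.typeset L) Y := by
  classical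
  by_contra hcon
  simp only [HasFiniteCopies, not_or, not_forall, exists_prop] at hcon
  obtain ⟨⟨A, hA, hAT, hAX⟩, B, hB, hBT, hBY⟩ := hcon
  have hD (D : Finset (T.typeset L)) :
      ∃ g : U ≃[L] U, g '' (Subtype.val '' (D : Set (T.typeset L))) ⊆ X ∪ Y :=
    h _ (D.finite_toSet.image _) (by rintro _ ⟨x, -, rfl⟩; exact x.2)
  choose g hg using hD
  -- Only finite parts of the typeset are known to map into `X ∪ Y`. An ultrafilter limit of the
  -- maps `g D` turns this into a cover of the typeset itself, and finite copies in the limit sets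
  -- transfer back through a single `D`.
  let 𝒰 : Ultrafilter (Finset (T.typeset L)) := Ultrafilter.of Filter.atTop
  have hle : (𝒰 : Filter (Finset (T.typeset L))) ≤ Filter.atTop := Ultrafilter.of_le _
  have hlim (Z Q : Set U) (hQ : Q.Finite) (k : U ≃[L] U)
      (hkQ : k '' Q ⊆ {v | ∀ᶠ D in (𝒰 : Filter (Finset (T.typeset L))), g D v ∈ Z}) :
      ∃ l : U ≃[L] U, l '' Q ⊆ Z := by
    have : ∀ᶠ D in (𝒰 : Filter (Finset (T.typeset L))), ∀ q ∈ Q, g D (k q) ∈ Z :=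
      (Filter.eventually_all_finite hQ).2 fun q hq => hkQ ⟨q, hq, rfl⟩
    obtain ⟨D, hD⟩ := this.exists
    refine ⟨(g D).comp k, ?_⟩
    rintro _ ⟨q, hq, rfl⟩
    exact hD q hq
  have hcov : T.typeset L ⊆ {v | ∀ᶠ D in (𝒰 : Filter (Finset (T.typeset L))), g D v ∈ X} ∪
      {v | ∀ᶠ D in (𝒰 : Filter (Finset (T.typeset L))), g D v ∈ Y} := by
    intro v hv
    refine Ultrafilter.eventually_or.1 ?_
    filter_upwards [hle (Filter.eventually_ge_atTop {⟨v, hv⟩})] with D hD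
    exact hg D ⟨v, ⟨⟨v, hv⟩, by simpa using hD, rfl⟩, rfl⟩
  obtain ⟨k, -, hk, -⟩ := T.exists_free_copy hhom hfree hcov hA hAT hB hBT
    (fun k hk => hBY (hlim Y B hB k hk)) ∅ finite_empty
  exact hAX (hlim X A hA k hk)

theorem PointType.exists_hasFiniteCopies_of_biUnion [L.IsRelational]
    (hhom : L.IsUltrahomogeneous U) (hfree : IsFreeAmalgamationClass (L.age U)) (T : PointType U)
    {ι : Type*} (J : Finset ι) (X : ι → Set U)
    (h : HasFiniteCopies L (T.typeset L) (⋃ j ∈ J, X j)) :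
    ∃ j ∈ J, HasFiniteCopies L (T.typeset L) (X j) := by
  classical
  induction J using Finset.induction_on with
  | empty =>
    obtain ⟨g, hg⟩ := h {T.point} (finite_singleton _) (by
      rintro _ rfl
      exact ⟨T.point_notMem, FirstOrder.Language.Equiv.refl L U, fun _ _ => rfl, rfl⟩)
    simp at hg
  | insert j J _ ih =>
    rw [Finset.set_biUnion_insert] at h
    rcases T.hasFiniteCopies_or hhom hfree h with h | h
    · exact ⟨j, Finset.mem_insert_self _ _, h⟩
    · obtain ⟨i, hi, hi'⟩ := ih h
      exact ⟨i, Finset.mem_insert_of_mem hi, hi'⟩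

theorem ageOn_subset_of_hasFiniteCopies [L.IsRelational] {S X : Set U}
    (h : HasFiniteCopies L S X) : ageOn L S ⊆ ageOn L X := by
  rintro M ⟨hfg, ⟨e⟩⟩
  let e' := (Substructure.subtype _).comp e
  have : Finite M := hfg.finite
  obtain ⟨g, hg⟩ := h (range e') (finite_range _) (by
    rintro _ ⟨x, rfl⟩
    exact (Substructure.mem_closure_iff_of_isRelational L _ _).1 (e x).2)
  exact ⟨hfg, ⟨Embedding.codRestrict _ (g.toEmbedding.comp e') fun x =>
    (Substructure.mem_closure_iff_of_isRelational L _ _).2 (hg ⟨_, ⟨x, rfl⟩, rfl⟩)⟩⟩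

end Typesets

/-! ### Copies of typesets and the colouring. -/

section Colouring

variable {L : FirstOrder.Language.{u, v}} {U : Type w} [L.Structure U]

variable (L) in
/-- The images of the typeset under all automorphisms. -/
def PointType.copies (T : PointType U) : Set (Set U) :=
  range fun g : U ≃[L] U => g '' T.typeset L

/-- A copy depends only on how the automorphism acts on the finite sockel, and a countable set
admits countably many such maps. -/
theorem PointType.countable_copies [Countable U] (T : PointType U) : (T.copies L).Countable := by
  have hfac : (fun g : U ≃[L] U => g '' T.typeset L).FactorsThrough
      fun (g : U ≃[L] U) (a : T.sockel) => g a := by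
    intro g h hgh
    have key (g h : U ≃[L] U) (hgh : ∀ a ∈ T.sockel, g a = h a) :
        g '' T.typeset L ⊆ h '' T.typeset L := by
      rintro _ ⟨y, hy, rfl⟩
      refine ⟨(h.symm.comp g) y, apply_mem_typeset (fun p hp => ?_) hy, h.apply_symm_apply _⟩
      rw [Equiv.comp_apply, hgh p hp, h.symm_apply_apply]
    exact (key g h fun a ha => congrFun hgh ⟨a, ha⟩).antisymm
      (key h g fun a ha => (congrFun hgh ⟨a, ha⟩).symm)
  obtain ⟨e, he⟩ := (Function.factorsThrough_iff _).1 hfac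
  rw [PointType.copies, he]
  exact (countable_range e).mono (range_comp_subset_range _ _)

/-- A self-embedding maps a typeset into a copy of it. -/
theorem PointType.exists_copy_of_embedding [L.IsRelational] (hhom : L.IsUltrahomogeneous U)
    (T : PointType U) (f : U ↪[L] U) : ∃ C ∈ T.copies L, f '' T.typeset L ⊆ C := by
  have hext {P : Set U} (hP : P.Finite) : ∃ g : U ≃[L] U, ∀ p ∈ P, g p = f p :=
    exists_equiv_of_partial_iso hhom hP f f.injective.injOn fun R t _ => f.map_rel R t
  obtain ⟨g, hg⟩ := hext T.sockel.finite_toSet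
  refine ⟨_, ⟨g, rfl⟩, ?_⟩
  rintro _ ⟨y, ⟨hyT, k, hk, rfl⟩, rfl⟩
  -- `g'` may vary with the point, but it agrees with `g` on the sockel, so every point lands in the
  -- same copy.
  obtain ⟨g', hg'⟩ := hext (T.sockel.finite_toSet.insert (k T.point))
  have hfix : Fixes (g.symm.comp g') (T.sockel : Set U) := fun p hp => by
    rw [Equiv.comp_apply, hg' p (.inr hp), ← hg p hp, g.symm_apply_apply]
  refine ⟨(g.symm.comp g') (k T.point), apply_mem_typeset hfix ⟨hyT, k, hk, rfl⟩, ?_⟩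
  rw [Equiv.comp_apply, g.apply_symm_apply, hg' _ (.inl rfl)]

/-- If a copy of `U` meets every copy of the typeset of `T` inside a finite union of copies of the
typeset of `T'`, then the rank of `T` is contained in that of `T'`. -/
theorem PointType.rank_subset_rank [L.IsRelational] (hhom : L.IsUltrahomogeneous U)
    (hfree : IsFreeAmalgamationClass (L.age U)) {T T' : PointType U} (f : U ↪[L] U)
    (hf : ∀ C ∈ T.copies L, ∃ J : Finset (Set U), (∀ D ∈ J, D ∈ T'.copies L) ∧
      range f ∩ C ⊆ ⋃ D ∈ J, D) : T.rank L ⊆ T'.rank L := by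
  obtain ⟨C, hC, hfC⟩ := T.exists_copy_of_embedding hhom f
  obtain ⟨J, hJ, hJC⟩ := hf C hC
  -- The preimages under `f` cover the typeset outright, so the identity witnesses the hypothesis.
  obtain ⟨D, hD, hcop⟩ := T.exists_hasFiniteCopies_of_biUnion hhom hfree J (fun D => f ⁻¹' D)
    (fun Q _ hQT => ⟨FirstOrder.Language.Equiv.refl L U, by
      rintro _ ⟨q, hq, rfl⟩
      have := hJC ⟨⟨q, rfl⟩, hfC ⟨q, hQT hq, rfl⟩⟩
      simpa using this⟩)
  obtain ⟨h, rfl⟩ := hJ D hD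
  refine ageOn_subset_of_hasFiniteCopies fun Q hQ hQT => ?_
  obtain ⟨g, hg⟩ := hcop Q hQ hQT
  obtain ⟨k, hk⟩ := exists_equiv_of_partial_iso hhom (hQ.image g) f f.injective.injOn
    fun R t _ => f.map_rel R t
  refine ⟨h.symm.comp (k.comp g), ?_⟩
  rintro _ ⟨q, hq, rfl⟩
  obtain ⟨y, hy, hyq⟩ : f (g q) ∈ h '' T'.typeset L := hg ⟨q, hq, rfl⟩
  rw [Equiv.comp_apply, Equiv.comp_apply, hk _ ⟨q, hq, rfl⟩, ← hyq, h.symm_apply_apply]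
  exact hy

/-- Given two countable families of sets, there is a colouring for which the points of colour `0` in
a member of the first family, and those of colour `1` in a member of the second, are covered by
finitely many members of the other family. -/
theorem exists_colouring {α : Type*} {𝒜 ℬ : Set (Set α)} (h𝒜 : 𝒜.Countable) (hℬ : ℬ.Countable) :
    ∃ c : α → Fin 2,
      (∀ A ∈ 𝒜, ∃ J : Finset (Set α), (∀ D ∈ J, D ∈ ℬ) ∧ {x | c x = 0} ∩ A ⊆ ⋃ D ∈ J, D) ∧
      ∀ B ∈ ℬ, ∃ J : Finset (Set α), (∀ D ∈ J, D ∈ 𝒜) ∧ {x | c x = 1} ∩ B ⊆ ⋃ D ∈ J, D := by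
  classical
  obtain ⟨e, he⟩ := countable_iff_exists_injOn.1 h𝒜
  obtain ⟨e', he'⟩ := countable_iff_exists_injOn.1 hℬ
  -- Colour `0` means that some `B` containing `x` is numbered no later than every `A` containing
  -- `x`. Only finitely many sets have a number up to a given bound.
  refine ⟨fun x => if ∃ B ∈ ℬ, x ∈ B ∧ ∀ A ∈ 𝒜, x ∈ A → e' B ≤ e A then 0 else 1, ?_, ?_⟩
  · intro A hA
    have hfin : {B ∈ ℬ | e' B ≤ e A}.Finite :=
      Finite.of_finite_image ((finite_Iic (e A)).subset (by rintro _ ⟨B, hB, rfl⟩; exact hB.2))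
        (he'.mono (sep_subset _ _))
    refine ⟨hfin.toFinset, fun D hD => ((hfin.mem_toFinset).1 hD).1, ?_⟩
    rintro x ⟨hx, hxA⟩
    by_cases hB : ∃ B ∈ ℬ, x ∈ B ∧ ∀ A ∈ 𝒜, x ∈ A → e' B ≤ e A
    · obtain ⟨B, hB, hxB, hle⟩ := hB
      exact mem_biUnion (hfin.mem_toFinset.2 ⟨hB, hle A hA hxA⟩) hxB
    · exact absurd ((if_neg hB).symm.trans hx) (by decide)
  · intro B hB
    have hfin : {A ∈ 𝒜 | e A < e' B}.Finite :=
      Finite.of_finite_image ((finite_Iio (e' B)).subset (by rintro _ ⟨A, hA, rfl⟩; exact hA.2))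
        (he.mono (sep_subset _ _))
    refine ⟨hfin.toFinset, fun D hD => ((hfin.mem_toFinset).1 hD).1, ?_⟩
    rintro x ⟨hx, hxB⟩
    by_cases hB' : ∃ B ∈ ℬ, x ∈ B ∧ ∀ A ∈ 𝒜, x ∈ A → e' B ≤ e A
    · exact absurd ((if_pos hB').symm.trans hx) (by decide)
    · push Not at hB'
      obtain ⟨A, hA, hxA, hlt⟩ := hB' B hB hxB
      exact mem_biUnion (hfin.mem_toFinset.2 ⟨hA, hlt⟩) hxA

end Colouring

end FreeAmalg

theorem theorem2p3 (L : FirstOrder.Language.{u, v}) [L.IsRelational]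
    (U : Type w) [L.Structure U] [Countable U]
    (hU : FreeAmalg.IsProper L U)
    (hhom : L.IsUltrahomogeneous U)
    (hfree : FreeAmalg.IsFreeAmalgamationClass (L.age U))
    (hrank : ¬ FreeAmalg.RankLinear L U) :
    FreeAmalg.Divisible L U := by
  intro hind
  apply hrank
  rintro _ ⟨T, rfl⟩ _ ⟨T', rfl⟩
  obtain ⟨c, hc0, hc1⟩ := FreeAmalg.exists_colouring
    (T.countable_copies (L := L)) (T'.countable_copies (L := L))
  obtain ⟨f, i, hf⟩ := hind c
  obtain rfl | rfl : i = 0 ∨ i = 1 := by omega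
  · left
    refine FreeAmalg.PointType.rank_subset_rank hhom hfree f fun C hC => ?_
    obtain ⟨J, hJ, hJC⟩ := hc0 C hC
    exact ⟨J, hJ, (Set.inter_subset_inter_left _ hf).trans hJC⟩
  · right
    refine FreeAmalg.PointType.rank_subset_rank hhom hfree f fun C hC => ?_
    obtain ⟨J, hJ, hJC⟩ := hc1 C hC
    exact ⟨J, hJ, (Set.inter_subset_inter_left _ hf).trans hJC⟩
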